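/- All digraphs are finite. An oriented graph is a digraph without loops and without pairs of opposite arcs. For an oriented graph $D$, let $\mathrm{fas}(D)$ be the minimum size of a set of arcs whose deletion makes $D$ acyclic. The inversion of a vertex set $X$ reverses all arcs with both endpoints in $X$. Let $\mathrm{inv}^{=p}(D)$ be the minimum number of successive inversions of vertex sets of size exactly $p$ that render $D$ acyclic ($+\infty$ if this is impossible). Let $p\ge 4$ be an even integer. Then, for every oriented graph $D$ of order $n\ge p+2$, the number $\mathrm{inv}^{=p}(D)$ is finite and (i) $\mathrm{inv}^{=p}(D)\le (2p-2)(\mathrm{fas}(D)+1)$; (ii) $\mathrm{inv}^{=p}(D)\le 2\,\mathrm{fas}(D)+2pn$; (iii) for every integer $k\ge 1$ with $n\ge p+2k-2$, $$\mathrm{inv}^{=p}(D)\le \mathrm{fas}(D)+\frac{p-2}{2}\,n^{1+1/k}+\Bigl((p-2)2^{k^2}+\frac{p-1}{2}\Bigr)n+1;$$ (iv) $\displaystyle \mathrm{inv}^{=p}(D)\le \frac{\mathrm{fas}(D)}{\lceil p/2\rceil\lfloor p/2\rfloor}+g_p(n)$, where $g_p:\mathbb N\to\mathbb R$ is a function depending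 only on $p$ with $g_p(n)=o(n^2)$ as $n\to\infty$. -/

import Mathlib

open Filter Asymptotics

universe u

namespace Digraph

/-- An oriented graph: no loops and no pair of opposite arcs (a loop would be its own opposite). -/
def IsOriented {V : Type u} (D : Digraph V) : Prop :=
  ∀ u v : V, D.Adj u v → ¬ D.Adj v u

/-- A digraph is acyclic if it has no directed cycle, equivalently no closed directed walk of
positive length. -/
def IsAcyclic {V : Type u} (D : Digraph V) : Prop :=
  ∀ v : V, ¬ Relation.TransGen D.Adj v v

/-- The digraph obtained by deleting the arcs in `F`. -/
def deleteArcs {V : Type u} (D : Digraph V) (F : Finset (V × V)) : Digraph V where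
  Adj u v := D.Adj u v ∧ (u, v) ∉ F

/-- A feedback arc set: a set of arcs whose deletion makes the digraph acyclic. -/
def IsFeedbackArcSet {V : Type u} (D : Digraph V) (F : Finset (V × V)) : Prop :=
  (∀ e ∈ F, D.Adj e.1 e.2) ∧ (D.deleteArcs F).IsAcyclic

/-- The feedback-arc-set number of a finite digraph: the minimum size of a feedback arc set.
(The set of all arcs is a feedback arc set, so for finite digraphs this is a minimum over a
nonempty set.) -/
noncomputable def fas {V : Type u} (D : Digraph V) : ℕ :=
  sInf {m : ℕ | ∃ F : Finset (V × V), D.IsFeedbackArcSet F ∧ F.card = m}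

/-- The inversion of a set `X` of vertices: reverse the arcs with both ends in `X`. -/
def invert {V : Type u} (D : Digraph V) (X : Finset V) : Digraph V where
  Adj u v := ((u ∈ X ∧ v ∈ X) ∧ D.Adj v u) ∨ (¬ (u ∈ X ∧ v ∈ X) ∧ D.Adj u v)

/-- The digraph obtained by inverting the members of a finite family one after another. -/
def invertFamily {V : Type u} (D : Digraph V) (L : List (Finset V)) : Digraph V :=
  L.foldl invert D

/-- A decycling `(=p)`-family: all its members have exactly `p` elements, and inverting all of
them yields an acyclic digraph. -/
def IsDecyclingEqFamily {V : Type u} (D : Digraph V) (p : ℕ) (L : List (Finset V)) : Prop :=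
  (∀ X ∈ L, X.card = p) ∧ (D.invertFamily L).IsAcyclic

/-- The `(=p)`-inversion number: the minimum number of `(=p)`-inversions rendering `D` acyclic,
or `⊤` if there is no decycling `(=p)`-family. -/
noncomputable def eqInvNumber {V : Type u} (D : Digraph V) (p : ℕ) : ℕ∞ :=
  ⨅ (L : List (Finset V)) (_ : D.IsDecyclingEqFamily p L), (L.length : ℕ∞)

end Digraph

/-! Only the parity of the number of inverted sets containing both ends of an arc matters. So, over
`ZMod 2` and off the diagonal, the task is to write the indicator of a suitable edge set `F` as a
sum of few cliques on `p` vertices. Take a vertex order with at most `fas D` backward arcs and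
reverse these; if their number is odd, toggle the pair of the first two vertices and exchange them
in the order. This gives an even `F` with `F.card ≤ D.fas + 1` (`exists_even_reversal`). When 4
divides `p`, a `p`-clique has evenly many edges, so only even sets are within reach.

Each bound then comes from a way of assembling even edge sets from cliques. A 4-cycle costs 4 and,
`p` being even, a path of two edges costs `2p - 2`; chaining paths pairs up arbitrary edges, whence
(i). For (ii), 4-cycles through a fixed vertex `w` remove adjacent edges at cost two each; the
remaining matching and the star at `w` cost only O(pn). For (iii), cliques `Z ∪ e` with one common
`(p - 2)`-set `Z` cost one per edge, and correcting the pairs at `Z` and `w` gives `fas D + 3(p -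
1)n`, below the stated bound for every `k`. For (iv), a copy of `K_{p,p}` has `p²` edges and costs
4. Remove copies greedily; by Kővári–Sós–Turán only `O(n^(2 - 1/p))` edges remain, and they are
handled as in (i). -/

namespace EqInversion

/-! ### Inversions as sums of cliques over `ZMod 2`. -/

section Parity

variable {V : Type u} [DecidableEq V]

/-- The indicator vector of a set of vertices over `ZMod 2`. -/
def chi (X : Finset V) : V → ZMod 2 := fun v => if v ∈ X then 1 else 0

/-- The symmetrized outer product of two vectors. -/
def wedge (a b : V → ZMod 2) : V → V → ZMod 2 := fun u v => a u * b v + b u * a v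

/-- The indicator of a set of edges, as a function of the two ends. -/
def edgeInd (F : Finset (Sym2 V)) : V → V → ZMod 2 := fun u v => if s(u, v) ∈ F then 1 else 0

/-- `Realizes p f m` says that at most `m` inversions of `p`-sets suffice to reverse exactly those
pairs of distinct vertices `u, v` with `f u v = 1`. -/
def Realizes (p : ℕ) (f : V → V → ZMod 2) (m : ℕ) : Prop :=
  ∃ L : List (Finset V), (∀ X ∈ L, X.card = p) ∧ L.length ≤ m ∧
    ∀ u v, u ≠ v → (L.map fun X => chi X u * chi X v).sum = f u v

theorem two_eq_zero : (2 : ZMod 2) = 0 := rfl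

theorem Realizes.add {p : ℕ} {f g : V → V → ZMod 2} {a b : ℕ} (hf : Realizes p f a)
    (hg : Realizes p g b) : Realizes p (f + g) (a + b) := by
  obtain ⟨L, hL, hl, hs⟩ := hf
  obtain ⟨M, hM, hm, ht⟩ := hg
  refine ⟨L ++ M, fun X hX => ?_, by simp; omega, fun u v huv => ?_⟩
  · rcases List.mem_append.1 hX with h | h
    exacts [hL X h, hM X h]
  · simp [hs u v huv, ht u v huv]

theorem Realizes.congr {p : ℕ} {f g : V → V → ZMod 2} {a b : ℕ} (hf : Realizes p f a)
    (hab : a ≤ b) (hfg : ∀ u v, u ≠ v → f u v = g u v) : Realizes p g b := by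
  obtain ⟨L, hL, hl, hs⟩ := hf
  exact ⟨L, hL, hl.trans hab, fun u v huv => (hs u v huv).trans (hfg u v huv)⟩

theorem Realizes.mono {p : ℕ} {f : V → V → ZMod 2} {a b : ℕ} (hf : Realizes p f a)
    (hab : a ≤ b) : Realizes p f b := hf.congr hab fun _ _ _ => rfl

theorem Realizes.zero (p : ℕ) : Realizes p (0 : V → V → ZMod 2) 0 := ⟨[], by simp, by simp, by simp⟩

theorem Realizes.clique {p : ℕ} {X : Finset V} (hX : X.card = p) :
    Realizes p (fun u v => chi X u * chi X v) 1 := ⟨[X], by simpa using hX, by simp, by simp⟩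

theorem Realizes.sum {p : ℕ} {ι : Type*} (s : Finset ι) (X : ι → Finset V)
    (hX : ∀ i ∈ s, (X i).card = p) :
    Realizes p (fun u v => ∑ i ∈ s, chi (X i) u * chi (X i) v) s.card := by
  classical
  induction s using Finset.induction_on with
  | empty => exact (Realizes.zero p).congr (by simp) (by simp)
  | insert a s ha ih =>
    refine ((Realizes.clique (hX a (by simp))).add (ih fun i hi => hX i (by simp [hi]))).congr
      (by rw [Finset.card_insert_of_notMem ha]; omega) fun u v _ => ?_
    rw [Finset.sum_insert ha]; rfl

theorem chi_insert {a : V} {X : Finset V} (ha : a ∉ X) (v : V) :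
    chi (insert a X) v = chi {a} v + chi X v := by
  unfold chi
  by_cases h : v = a
  · subst h; simp [ha]
  · simp [h]

theorem chi_singleton_mul {a u v : V} (h : u ≠ v) : chi {a} u * chi {a} v = 0 := by
  unfold chi
  by_cases hu : u = a
  · subst hu; simp [h.symm]
  · simp [hu]

theorem chi_empty (v : V) : chi (∅ : Finset V) v = 0 := by simp [chi]

theorem chi_union {X Y : Finset V} (h : Disjoint X Y) (v : V) :
    chi (X ∪ Y) v = chi X v + chi Y v := by
  unfold chi
  by_cases hx : v ∈ X
  · simp [hx, Finset.disjoint_left.1 h hx]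
  · simp [hx]

theorem edgeInd_empty : edgeInd (∅ : Finset (Sym2 V)) = 0 := by
  ext u v; simp [edgeInd]

theorem edgeInd_union {E F : Finset (Sym2 V)} (h : Disjoint E F) :
    edgeInd (E ∪ F) = edgeInd E + edgeInd F := by
  ext u v
  simp only [edgeInd, Pi.add_apply]
  by_cases hx : s(u, v) ∈ E
  · simp [hx, Finset.disjoint_left.1 h hx]
  · simp [hx]

theorem edgeInd_insert {e : Sym2 V} {F : Finset (Sym2 V)} (h : e ∉ F) :
    edgeInd (insert e F) = edgeInd {e} + edgeInd F := by
  rw [Finset.insert_eq, edgeInd_union (by simpa using h)]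

theorem edgeInd_singleton {a b : V} (hab : a ≠ b) :
    edgeInd {s(a, b)} = wedge (chi {a}) (chi {b}) := by
  ext u v
  simp only [edgeInd, wedge, chi, Finset.mem_singleton, Sym2.eq_iff]
  by_cases h1 : u = a <;> by_cases h2 : v = b <;> by_cases h3 : u = b <;> by_cases h4 : v = a <;>
    simp_all

theorem exists_card_eq_disjoint [Fintype V] {m : ℕ} (S : Finset V) (h : m + S.card ≤ Fintype.card V) :
    ∃ Z : Finset V, Z.card = m ∧ Disjoint Z S := by
  obtain ⟨Z, hZ, hc⟩ := Finset.exists_subset_card_eq (s := Sᶜ) (n := m)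
    (by rw [Finset.card_compl]; omega)
  exact ⟨Z, hc, Finset.disjoint_left.2 fun x hx => by simpa using hZ hx⟩

/-- Even sets are built two elements at a time because the gadgets handle pairs of edges or
vertices. -/
theorem even_card_induction {α : Type*} [DecidableEq α] {P : Finset α → Prop} (h0 : P ∅)
    (h2 : ∀ a b s, a ≠ b → a ∉ s → b ∉ s → P s → P (insert a (insert b s))) :
    ∀ s : Finset α, Even s.card → P s := by
  intro s
  induction s using Finset.strongInduction with
  | H s ih =>
    intro hs
    rcases s.eq_empty_or_nonempty with rfl | ⟨a, ha⟩
    · exact h0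
    have hc : (s.erase a).card + 1 = s.card := Finset.card_erase_add_one ha
    have hne : (s.erase a).Nonempty := by
      rw [← Finset.card_pos]
      rcases hs with ⟨r, hr⟩
      omega
    obtain ⟨b, hb⟩ := hne
    have hc' : ((s.erase a).erase b).card + 1 = (s.erase a).card := Finset.card_erase_add_one hb
    have := h2 a b ((s.erase a).erase b) (Finset.ne_of_mem_erase hb).symm (by simp) (by simp)
      (ih _ (((Finset.erase_ssubset hb).trans (Finset.erase_ssubset ha))) (by
        rcases hs with ⟨r, hr⟩
        exact ⟨r - 1, by omega⟩))
    rwa [Finset.insert_erase hb, Finset.insert_erase ha] at this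

end Parity

/-! ### Small gadgets: 4-cycles, paths of two edges, pairs of edges, stars. -/

section Gadgets

variable {V : Type u} [DecidableEq V] [Fintype V] {p : ℕ}

/-- The four edges of a 4-cycle are reversed by four inversions. -/
theorem realizes_fourCycle (hp : 2 ≤ p) (hn : p + 2 ≤ Fintype.card V) {a b c d : V}
    (hab : a ≠ b) (hbc : b ≠ c) (hcd : c ≠ d) (hda : d ≠ a) :
    Realizes p (wedge (chi {a}) (chi {b}) + wedge (chi {b}) (chi {c}) + wedge (chi {c}) (chi {d}) +
      wedge (chi {d}) (chi {a})) 4 := by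
  -- The four inverted sets are `Z` plus one edge of the cycle: pairs inside `Z` are covered four
  -- times, pairs between `Z` and a corner an even number of times. Finding `Z` outside the corners
  -- is what `p + 2 ≤ n` is for.
  obtain ⟨Z, hZ, hd⟩ := exists_card_eq_disjoint (m := p - 2) ({a, b, c, d} : Finset V)
    (by have := Finset.card_le_four (a := a) (b := b) (c := c) (d := d); omega)
  have ha : a ∉ Z := fun h => Finset.disjoint_left.1 hd h (by simp)
  have hb : b ∉ Z := fun h => Finset.disjoint_left.1 hd h (by simp)
  have hc : c ∉ Z := fun h => Finset.disjoint_left.1 hd h (by simp)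
  have hd : d ∉ Z := fun h => Finset.disjoint_left.1 hd h (by simp)
  have key : ∀ {x y : V}, x ∉ Z → y ∉ Z → x ≠ y → Realizes p
      (fun u v => (chi {x} u + (chi {y} u + chi Z u)) * (chi {x} v + (chi {y} v + chi Z v))) 1 := by
    intro x y hx hy hxy
    have h1 : x ∉ insert y Z := by simp [hx, hxy]
    refine (Realizes.clique (X := insert x (insert y Z)) ?_).congr le_rfl fun u v _ => ?_
    · rw [Finset.card_insert_of_notMem h1, Finset.card_insert_of_notMem hy]; omega
    · simp only [chi_insert h1, chi_insert hy]
  refine ((((key ha hb hab).add (key hb hc hbc)).add (key hc hd hcd)).add (key hd ha hda)).congr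
    le_rfl fun u v _ => ?_
  simp only [Pi.add_apply, wedge]
  linear_combination (2 * chi Z u * chi Z v + chi Z u * (chi {a} v + chi {b} v + chi {c} v +
    chi {d} v) + chi Z v * (chi {a} u + chi {b} u + chi {c} u + chi {d} u) + chi {a} u * chi {a} v +
    chi {b} u * chi {b} v + chi {c} u * chi {c} v + chi {d} u * chi {d} v) * two_eq_zero

/-- The edges of the complete bipartite graph between two vertices and an even set. -/
theorem realizes_twoStars (hp : 2 ≤ p) (hn : p + 2 ≤ Fintype.card V) {a c : V} :
    ∀ S : Finset V, Even S.card → (a ∉ S → c ∉ S →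
      Realizes p (wedge (chi S) (chi {a} + chi {c})) (2 * S.card)) := by
  refine even_card_induction ?_ ?_
  · intro _ _
    refine (Realizes.zero p).congr (by simp) fun u v _ => ?_
    simp [wedge, chi_empty]
  · intro x y s hxy hx hy ih ha hc
    simp only [Finset.mem_insert, not_or] at ha hc
    have hx' : x ∉ insert y s := by simp [hx, hxy]
    -- The case `a = c` is harmless, since only consecutive corners must differ.
    refine ((ih ha.2.2 hc.2.2).add (realizes_fourCycle hp hn (a := a) (b := x) (c := c) (d := y)
      ha.1 (Ne.symm hc.1) hc.2.1 (Ne.symm ha.2.1))).congr ?_ fun u v _ => ?_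
    · rw [Finset.card_insert_of_notMem hx', Finset.card_insert_of_notMem hy]; omega
    · simp only [Pi.add_apply, wedge, chi_insert hx', chi_insert hy]
      ring

/-- The cliques on `Z ∪ {a, b}` and `Z ∪ {c, b}` sum to the path plus all pairs between `Z` and `{a,
c}`. Since `Z` has even size `p - 2`, `realizes_twoStars` clears these at cost `2(p - 2)`. -/
theorem realizes_path (hp : 2 ≤ p) (hpe : Even p) (hn : p + 2 ≤ Fintype.card V) {a b c : V}
    (hab : a ≠ b) (hbc : b ≠ c) :
    Realizes p (wedge (chi {a}) (chi {b}) + wedge (chi {b}) (chi {c})) (2 * p - 2) := by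
  by_cases hac : a = c
  · subst hac
    refine (Realizes.zero p).congr (by omega) fun u v _ => ?_
    simp only [Pi.add_apply, wedge, Pi.zero_apply]
    linear_combination (-(chi {a} u * chi {b} v + chi {b} u * chi {a} v)) * two_eq_zero
  obtain ⟨Z, hZ, hd⟩ := exists_card_eq_disjoint (m := p - 2) ({a, b, c} : Finset V)
    (by have := Finset.card_le_three (a := a) (b := b) (c := c); omega)
  have ha : a ∉ Z := fun h => Finset.disjoint_left.1 hd h (by simp)
  have hb : b ∉ Z := fun h => Finset.disjoint_left.1 hd h (by simp)
  have hc : c ∉ Z := fun h => Finset.disjoint_left.1 hd h (by simp)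
  have ha' : a ∉ insert b Z := by simp [ha, hab]
  have hc' : c ∉ insert b Z := by simp [hc, hbc.symm]
  have e1 := Realizes.clique (p := p) (X := insert a (insert b Z))
    (by rw [Finset.card_insert_of_notMem ha', Finset.card_insert_of_notMem hb]; omega)
  have e2 := Realizes.clique (p := p) (X := insert c (insert b Z))
    (by rw [Finset.card_insert_of_notMem hc', Finset.card_insert_of_notMem hb]; omega)
  refine ((e1.add e2).add (realizes_twoStars hp hn Z
    (by rw [hZ]; exact hpe.tsub (by decide)) ha hc)).congr (by omega) fun u v huv => ?_
  simp only [Pi.add_apply, wedge, chi_insert ha', chi_insert hc', chi_insert hb]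
  linear_combination (chi Z u * chi Z v + (chi {b} u * chi {b} v) + chi Z u * (chi {a} v +
    chi {b} v + chi {c} v) + chi Z v * (chi {a} u + chi {b} u + chi {c} u)) * two_eq_zero +
    chi_singleton_mul (a := a) huv + chi_singleton_mul (a := c) huv

/-- The edge `bc` serves as a bridge: the paths `abc` and `bcd` share it, so it cancels. -/
theorem realizes_twoEdges (hp : 2 ≤ p) (hpe : Even p) (hn : p + 2 ≤ Fintype.card V) {a b c d : V}
    (hab : a ≠ b) (hcd : c ≠ d) :
    Realizes p (wedge (chi {a}) (chi {b}) + wedge (chi {c}) (chi {d})) (2 * (2 * p - 2)) := by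
  by_cases hbc : b = c
  · subst hbc
    exact (realizes_path hp hpe hn hab hcd).mono (by omega)
  · refine ((realizes_path hp hpe hn hab hbc).add (realizes_path hp hpe hn hbc hcd)).congr
      (by omega) fun u v _ => ?_
    simp only [Pi.add_apply, wedge]
    linear_combination (chi {b} u * chi {c} v + chi {c} u * chi {b} v) * two_eq_zero

/-- Any even set of edges is reversed by at most `2 * p - 2` inversions per edge. -/
theorem realizes_edgeInd (hp : 2 ≤ p) (hpe : Even p) (hn : p + 2 ≤ Fintype.card V) :
    ∀ F : Finset (Sym2 V), Even F.card → ((∀ e ∈ F, ¬ e.IsDiag) →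
      Realizes p (edgeInd F) ((2 * p - 2) * F.card)) := by
  refine even_card_induction ?_ ?_
  · intro _
    rw [edgeInd_empty]
    exact Realizes.zero p
  · intro e f s hef he hf ih hdiag
    have he' : e ∉ insert f s := by simp [he, hef]
    have h1 := hdiag e (by simp)
    have h2 := hdiag f (by simp)
    have h3 := ih fun x hx => hdiag x (by simp [hx])
    rw [edgeInd_insert he', edgeInd_insert hf, Finset.card_insert_of_notMem he',
      Finset.card_insert_of_notMem hf, ← add_assoc]
    induction e using Sym2.ind with | _ a b
    induction f using Sym2.ind with | _ c d
    have hab : a ≠ b := by simpa using h1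
    have hcd : c ≠ d := by simpa using h2
    rw [edgeInd_singleton hab, edgeInd_singleton hcd]
    exact ((realizes_twoEdges hp hpe hn hab hcd).add h3).mono (by ring_nf; omega)

/-- An even star is reversed by at most `p - 1` inversions per edge. -/
theorem realizes_star (hp : 2 ≤ p) (hpe : Even p) (hn : p + 2 ≤ Fintype.card V) (w : V) :
    ∀ S : Finset V, Even S.card → (w ∉ S →
      Realizes p (wedge (chi {w}) (chi S)) ((p - 1) * S.card)) := by
  refine even_card_induction ?_ ?_
  · intro _
    refine (Realizes.zero p).congr (by simp) fun u v _ => ?_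
    simp [wedge, chi_empty]
  · intro x y s hxy hx hy ih hw
    simp only [Finset.mem_insert, not_or] at hw
    have hx' : x ∉ insert y s := by simp [hx, hxy]
    refine ((ih hw.2.2).add (realizes_path hp hpe hn (Ne.symm hw.1) hw.2.1)).congr ?_
      fun u v _ => ?_
    · rw [Finset.card_insert_of_notMem hx', Finset.card_insert_of_notMem hy]
      have : 2 * p - 2 = (p - 1) * 2 := by omega
      rw [this, ← mul_add]
    · simp only [Pi.add_apply, wedge, chi_insert hx', chi_insert hy]
      ring

end Gadgets

/-! ### Reducing an edge set to a star at a fixed vertex `w`. -/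

section EdgeBounds

variable {V : Type u} [DecidableEq V] [Fintype V] {p : ℕ}

theorem sum_chi (X : Finset V) : ∑ v, chi X v = (X.card : ZMod 2) := by
  simp [chi]

theorem chi_support (c : V → ZMod 2) : chi (Finset.univ.filter fun v => c v ≠ 0) = c := by
  ext v
  have : ∀ x : ZMod 2, (if x ≠ 0 then 1 else 0) = x := by decide
  simpa [chi] using this (c v)

theorem even_card_support {c : V → ZMod 2} (h : ∑ v, c v = 0) :
    Even (Finset.univ.filter fun v => c v ≠ 0).card := by
  rw [← chi_support c, sum_chi] at h
  exact (ZMod.natCast_eq_zero_iff_even).1 h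

omit [Fintype V] in
theorem edgeInd_add_self (F : Finset (Sym2 V)) (u v : V) :
    edgeInd F u v + edgeInd F u v = 0 := CharTwo.add_self_eq_zero _

/-- Four-cycles through `w` reduce a set of edges to a matching and a star at `w`. -/
theorem exists_matching_realizes (hp : 2 ≤ p) (hn : p + 2 ≤ Fintype.card V) (w : V)
    (F : Finset (Sym2 V)) (hdiag : ∀ e ∈ F, ¬ e.IsDiag) (hw : ∀ e ∈ F, w ∉ e) :
    ∃ M ⊆ F, (∀ e ∈ M, ∀ f ∈ M, ∀ x, x ∈ e → x ∈ f → e = f) ∧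
      ∃ (k : ℕ) (c : V → ZMod 2), c w = 0 ∧ ∑ v, c v = 0 ∧ F.card = M.card + 2 * k ∧
        Realizes p (edgeInd F + edgeInd M + wedge (chi {w}) c) (4 * k) := by
  induction F using Finset.strongInduction with
  | H F ih =>
    by_cases hM : ∀ e ∈ F, ∀ f ∈ F, ∀ x, x ∈ e → x ∈ f → e = f
    · refine ⟨F, subset_rfl, hM, 0, 0, rfl, by simp, by simp, ?_⟩
      refine (Realizes.zero p).congr (by simp) fun u v _ => ?_
      simp [wedge, edgeInd_add_self]
    push Not at hM
    obtain ⟨e, he, f, hf, y, hye, hyf, hef⟩ := hM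
    obtain ⟨x, rfl⟩ := Sym2.mem_iff_exists.1 hye
    obtain ⟨z, rfl⟩ := Sym2.mem_iff_exists.1 hyf
    have hf' : s(y, z) ∈ F.erase s(y, x) := Finset.mem_erase.2 ⟨hef.symm, hf⟩
    set E := (F.erase s(y, x)).erase s(y, z) with hE
    have hsub : E ⊂ F := (Finset.erase_ssubset hf').trans (Finset.erase_ssubset he)
    obtain ⟨M, hMs, hM, k, c, hcw, hc, hk, hr⟩ := ih E hsub (fun e h => hdiag e (hsub.1 h))
      fun e h => hw e (hsub.1 h)
    have hyx : y ≠ x := by simpa using hdiag _ he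
    have hyz : y ≠ z := by simpa using hdiag _ hf
    have hwx := hw _ he
    have hwz := hw _ hf
    simp only [Sym2.mem_iff, not_or] at hwx hwz
    have hF : F = insert s(y, x) (insert s(y, z) E) := by
      rw [hE, Finset.insert_erase hf', Finset.insert_erase he]
    have h1 : s(y, z) ∉ E := by simp [hE]
    have h2 : s(y, x) ∉ insert s(y, z) E := by simp [hE, hef]
    -- The 4-cycle `x y z w` trades the edges `xy`, `yz` for the star edges `wx`, `wz`, so the star
    -- stays even.
    refine ⟨M, hMs.trans hsub.1, hM, k + 1, c + (chi {x} + chi {z}), ?_, ?_, ?_, ?_⟩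
    · simp [hcw, chi, hwx.2, hwz.2]
    · simp only [Pi.add_apply, Finset.sum_add_distrib, hc, sum_chi, Finset.card_singleton]
      rfl
    · rw [hF, Finset.card_insert_of_notMem h2, Finset.card_insert_of_notMem h1]; omega
    · refine (hr.add (realizes_fourCycle hp hn (a := x) (b := y) (c := z) (d := w) hyx.symm hyz
        (Ne.symm hwz.2) hwx.2)).congr (by omega) fun u v _ => ?_
      rw [hF, edgeInd_insert h2, edgeInd_insert h1, edgeInd_singleton hyx, edgeInd_singleton hyz]
      simp only [Pi.add_apply, wedge]
      ring

/-- The path `a b w` trades an edge `ab` for the star edge `bw`. -/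
theorem exists_star_realizes (hp : 2 ≤ p) (hpe : Even p) (hn : p + 2 ≤ Fintype.card V) (w : V)
    (M : Finset (Sym2 V)) (hdiag : ∀ e ∈ M, ¬ e.IsDiag) (hw : ∀ e ∈ M, w ∉ e) :
    ∃ c : V → ZMod 2, c w = 0 ∧ ∑ v, c v = M.card ∧
      Realizes p (edgeInd M + wedge (chi {w}) c) ((2 * p - 2) * M.card) := by
  induction M using Finset.induction_on with
  | empty =>
    refine ⟨0, rfl, by simp, (Realizes.zero p).congr (by simp) fun u v _ => ?_⟩
    simp [edgeInd_empty, wedge]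
  | insert e M he ih =>
    obtain ⟨c, hcw, hc, hr⟩ := ih (fun e h => hdiag e (by simp [h])) fun e h => hw e (by simp [h])
    have h1 := hdiag e (by simp)
    have h2 := hw e (by simp)
    induction e using Sym2.ind with | _ a b
    have hab : a ≠ b := by simpa using h1
    simp only [Sym2.mem_iff, not_or] at h2
    refine ⟨c + chi {b}, by simp [hcw, chi, h2.2], ?_, ?_⟩
    · simp only [Pi.add_apply, Finset.sum_add_distrib, hc, sum_chi, Finset.card_singleton]
      rw [Finset.card_insert_of_notMem he]; push_cast; rfl
    · refine (hr.add (realizes_path hp hpe hn hab (Ne.symm h2.2))).congr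
        (by rw [Finset.card_insert_of_notMem he]; exact (mul_add_one _ _).ge) fun u v _ => ?_
      rw [edgeInd_insert he, edgeInd_singleton hab]
      simp only [Pi.add_apply, wedge]
      ring

theorem two_mul_card_matching_le (w : V) (M : Finset (Sym2 V)) (hdiag : ∀ e ∈ M, ¬ e.IsDiag)
    (hw : ∀ e ∈ M, w ∉ e) (hM : ∀ e ∈ M, ∀ f ∈ M, ∀ x, x ∈ e → x ∈ f → e = f) :
    2 * M.card ≤ Fintype.card V - 1 := by
  have h1 : (M.biUnion Sym2.toFinset).card = ∑ e ∈ M, e.toFinset.card := by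
    refine Finset.card_biUnion fun e he f hf hef => Finset.disjoint_left.2 fun x hx hx' => ?_
    exact hef (hM e he f hf x (Sym2.mem_toFinset.1 hx) (Sym2.mem_toFinset.1 hx'))
  rw [Finset.sum_congr rfl fun e he => Sym2.card_toFinset_of_not_isDiag e (hdiag e he),
    Finset.sum_const, smul_eq_mul, mul_comm] at h1
  rw [← h1, ← Finset.card_univ, ← Finset.card_erase_of_mem (Finset.mem_univ w)]
  refine Finset.card_le_card fun x hx => ?_
  obtain ⟨e, he, hx⟩ := Finset.mem_biUnion.1 hx
  exact Finset.mem_erase.2 ⟨fun h => hw e he (h ▸ Sym2.mem_toFinset.1 hx), Finset.mem_univ _⟩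

/-- An even set of edges together with a star at `w` is reversed by about two inversions per
edge. -/
theorem realizes_edgeInd_add_star (hp : 2 ≤ p) (hpe : Even p) (hn : p + 2 ≤ Fintype.card V) (w : V)
    (F : Finset (Sym2 V)) (hdiag : ∀ e ∈ F, ¬ e.IsDiag) (hw : ∀ e ∈ F, w ∉ e)
    (c : V → ZMod 2) (hcw : c w = 0) (hc : ∑ v, c v = F.card) :
    Realizes p (edgeInd F + wedge (chi {w}) c)
      (2 * F.card + (2 * p - 2) * (Fintype.card V - 1)) := by
  obtain ⟨M, hMF, hM, k, c₁, hc₁w, hc₁, hk, h₁⟩ := exists_matching_realizes hp hn w F hdiag hw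
  obtain ⟨c₂, hc₂w, hc₂, h₂⟩ := exists_star_realizes hp hpe hn w M
    (fun e h => hdiag e (hMF h)) fun e h => hw e (hMF h)
  -- All that is left is a star at `w`. It is even because `c` has the parity of `F`, `c₁` is even,
  -- `c₂` has the parity of `M`, and `F.card - M.card = 2k`.
  set C := Finset.univ.filter fun v => (c + c₁ + c₂) v ≠ 0 with hC
  have hCe : Even C.card := by
    refine even_card_support ?_
    simp only [Pi.add_apply, Finset.sum_add_distrib, hc, hc₁, hc₂, hk]
    push_cast
    linear_combination ((M.card : ZMod 2) + k) * two_eq_zero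
  have hwC : w ∉ C := by simp [hC, hcw, hc₁w, hc₂w]
  have hCcard : C.card ≤ Fintype.card V - 1 := by
    rw [← Finset.card_univ, ← Finset.card_erase_of_mem (Finset.mem_univ w)]
    exact Finset.card_le_card fun x hx =>
      Finset.mem_erase.2 ⟨fun h => hwC (h ▸ hx), Finset.mem_univ _⟩
  have hMcard := two_mul_card_matching_le w M (fun e h => hdiag e (hMF h))
    (fun e h => hw e (hMF h)) hM
  have h₃ := realizes_star hp hpe hn w C hCe hwC
  rw [hC, chi_support, ← hC] at h₃
  refine ((h₁.add h₂).add h₃).congr ?_ fun u v _ => ?_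
  -- The cost is `2|F| + (2p - 4)|M| + (p - 1)|C|`, with `2|M|` and `|C|` at most `n - 1`.
  · obtain ⟨q, rfl⟩ : ∃ q, p = q + 2 := ⟨p - 2, by omega⟩
    have e1 : 2 * (q + 2) - 2 = 2 * q + 2 := by omega
    have e2 : q + 2 - 1 = q + 1 := by omega
    rw [e1, e2, hk]
    nlinarith [Nat.mul_le_mul_left q hMcard, Nat.mul_le_mul_left (q + 1) hCcard]
  · simp only [Pi.add_apply, wedge]
    linear_combination edgeInd_add_self M u v + ((chi {w} u * c₁ v + c₁ u * chi {w} v) +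
      (chi {w} u * c₂ v + c₂ u * chi {w} v)) * two_eq_zero

/-- The degrees modulo 2 of a set of edges. -/
def degreeParity (H : Finset (Sym2 V)) : V → ZMod 2 := fun v => ∑ e ∈ H, chi e.toFinset v

theorem sum_degreeParity (H : Finset (Sym2 V)) (hdiag : ∀ e ∈ H, ¬ e.IsDiag) :
    ∑ v, degreeParity H v = 0 := by
  unfold degreeParity
  rw [Finset.sum_comm]
  refine Finset.sum_eq_zero fun e he => ?_
  rw [sum_chi, Sym2.card_toFinset_of_not_isDiag e (hdiag e he)]
  rfl

omit [Fintype V] in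
theorem degreeParity_eq_zero {H : Finset (Sym2 V)} {x : V} (h : ∀ e ∈ H, x ∉ e) :
    degreeParity H x = 0 :=
  Finset.sum_eq_zero fun e he => by simp [chi, Sym2.mem_toFinset, h e he]

omit [Fintype V] in
theorem sum_chi_toFinset_mul (H : Finset (Sym2 V)) {u v : V} (huv : u ≠ v) :
    ∑ e ∈ H, chi e.toFinset u * chi e.toFinset v = edgeInd H u v := by
  have h : ∀ e ∈ H, chi e.toFinset u * chi e.toFinset v = if e = s(u, v) then 1 else 0 := by
    intro e _
    simp only [chi, Sym2.mem_toFinset, ← Sym2.mem_and_mem_iff huv]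
    by_cases h1 : u ∈ e <;> by_cases h2 : v ∈ e <;> simp [h1, h2]
  rw [Finset.sum_congr rfl h]
  simp [edgeInd]

omit [Fintype V] in
theorem sum_chi_singleton (S : Finset V) (v : V) : ∑ x ∈ S, chi {x} v = chi S v := by
  simp [chi]

/-- An even set of edges avoiding a common `(p - 2)`-set is reversed, up to a star at `w`, by
essentially one inversion per edge. -/
theorem realizes_of_avoids (hp : 2 ≤ p) {Z : Finset V} (hZ : Z.card = p - 2) {w : V} (hwZ : w ∉ Z)
    (H : Finset (Sym2 V)) (hH : Even H.card) (hdiag : ∀ e ∈ H, ¬ e.IsDiag) (hw : ∀ e ∈ H, w ∉ e)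
    (hHZ : ∀ e ∈ H, ∀ x ∈ Z, x ∉ e) :
    Realizes p (edgeInd H + wedge (chi {w}) (degreeParity H)) (H.card + Fintype.card V) := by
  set O := Finset.univ.filter fun v => degreeParity H v ≠ 0 with hO
  have hOe : (O.card : ZMod 2) = 0 :=
    (ZMod.natCast_eq_zero_iff_even).2 (even_card_support (sum_degreeParity H hdiag))
  have hHe : (H.card : ZMod 2) = 0 := (ZMod.natCast_eq_zero_iff_even).2 hH
  have hOdeg : chi O = degreeParity H := chi_support _
  have hwO : ∀ x ∈ O, x ≠ w := by
    rintro x hx rfl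
    exact (Finset.mem_filter.1 hx).2 (degreeParity_eq_zero hw)
  have hZO : ∀ x ∈ O, x ∉ Z := fun x hx hxZ =>
    (Finset.mem_filter.1 hx).2 (degreeParity_eq_zero fun e he => hHZ e he x hxZ)
  have hdisj : ∀ e ∈ H, Disjoint Z e.toFinset := fun e he =>
    Finset.disjoint_left.2 fun x hx hxe => hHZ e he x hx (Sym2.mem_toFinset.1 hxe)
  have hmem : ∀ x ∈ O, w ∉ insert x Z := fun x hx => by
    simp [hwZ, Ne.symm (hwO x hx)]
  -- Pairs inside `Z` cancel because `H` is even, leaving `H` and the pairs between `Z` and the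
  -- odd-degree vertices `O`.
  have r1 := Realizes.sum (p := p) H (fun e => Z ∪ e.toFinset) fun e he => by
    rw [Finset.card_union_of_disjoint (hdisj e he),
      Sym2.card_toFinset_of_not_isDiag e (hdiag e he)]
    omega
  -- These sets clear the pairs between `Z` and `O`. Pairs inside `Z ∪ {w}` cancel because `O` is
  -- even, and the star from `w` to `O` remains.
  have r2 := Realizes.sum (p := p) O (fun x => insert w (insert x Z)) fun x hx => by
    rw [Finset.card_insert_of_notMem (hmem x hx), Finset.card_insert_of_notMem (hZO x hx)]
    omega
  refine (r1.add r2).congr (Nat.add_le_add_left (Finset.card_le_univ O) _) fun u v huv => ?_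
  have s1 : ∑ e ∈ H, chi (Z ∪ e.toFinset) u * chi (Z ∪ e.toFinset) v =
      ∑ e ∈ H, (chi Z u * chi Z v + chi Z u * chi e.toFinset v + chi Z v * chi e.toFinset u +
        chi e.toFinset u * chi e.toFinset v) := by
    refine Finset.sum_congr rfl fun e he => ?_
    rw [chi_union (hdisj e he), chi_union (hdisj e he)]
    ring
  have s2 : ∑ x ∈ O, chi (insert w (insert x Z)) u * chi (insert w (insert x Z)) v =
      ∑ x ∈ O, ((chi {w} u + chi Z u) * (chi {w} v + chi Z v) +
        (chi {w} u + chi Z u) * chi {x} v + (chi {w} v + chi Z v) * chi {x} u) := by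
    refine Finset.sum_congr rfl fun x hx => ?_
    simp only [chi_insert (hmem x hx), chi_insert (hZO x hx)]
    linear_combination chi_singleton_mul (a := x) huv
  have hd : ∀ x, ∑ e ∈ H, chi e.toFinset x = degreeParity H x := fun _ => rfl
  simp only [Pi.add_apply, s1, s2, Finset.sum_add_distrib, ← Finset.mul_sum, Finset.sum_const,
    nsmul_eq_mul, hHe, hOe, sum_chi_toFinset_mul H huv, sum_chi_singleton, hOdeg, hd, wedge]
  linear_combination (chi Z u * degreeParity H v + chi Z v * degreeParity H u) * two_eq_zero

end EdgeBounds

/-! ### From feedback arc sets to even sets of pairs to be reversed. -/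

section Acyclicity

variable {V : Type u} [DecidableEq V]

theorem invertFamily_adj (D : Digraph V) (L : List (Finset V)) (u v : V) :
    (D.invertFamily L).Adj u v ↔
      if (L.map fun X => chi X u * chi X v).sum = 0 then D.Adj u v else D.Adj v u := by
  induction L generalizing D with
  | nil => simp [Digraph.invertFamily]
  | cons X L ih =>
    have h : D.invertFamily (X :: L) = (D.invert X).invertFamily L := rfl
    rw [h, ih, List.map_cons, List.sum_cons]
    have hx : ∀ x : ZMod 2, 1 + x = 0 ↔ ¬ x = 0 := by decide
    generalize (L.map fun X => chi X u * chi X v).sum = x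
    by_cases hu : u ∈ X <;> by_cases hv : v ∈ X <;> by_cases h0 : x = 0 <;>
      simp [Digraph.invert, chi, hu, hv, h0, hx]

omit [DecidableEq V] in
theorem isAcyclic_of_lt {D : Digraph V} (key : V → ℕ) (h : ∀ u v, D.Adj u v → key u < key v) :
    D.IsAcyclic := by
  intro v hv
  have : ∀ w, Relation.TransGen D.Adj v w → key v < key w := by
    intro w hw
    induction hw with
    | single h' => exact h _ _ h'
    | tail _ h' ih => exact ih.trans (h _ _ h')
  exact lt_irrefl _ (this v hv)

omit [DecidableEq V] in
theorem exists_injective_key [Fintype V] {D : Digraph V} (hD : D.IsAcyclic) :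
    ∃ key : V → ℕ, Function.Injective key ∧ ∀ u v, D.Adj u v → key u < key v := by
  classical
  let r : V → ℕ := fun v => (Finset.univ.filter fun u => Relation.TransGen D.Adj u v).card
  have hr : ∀ u v, D.Adj u v → r u < r v := fun u v huv => by
    refine Finset.card_lt_card ⟨fun x hx => ?_, fun hs => ?_⟩
    · simp only [Finset.mem_filter, Finset.mem_univ, true_and] at hx ⊢
      exact hx.tail huv
    · have := hs (Finset.mem_filter.2 ⟨Finset.mem_univ u, Relation.TransGen.single huv⟩)
      exact hD u (Finset.mem_filter.1 this).2
  let i := Fintype.equivFin V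
  -- The ancestor count `r` increases strictly along arcs; the enumeration `i`, as a residue modulo
  -- `n`, breaks ties.
  refine ⟨fun v => i v + Fintype.card V * r v, fun u v huv => ?_, fun u v huv => ?_⟩
  · have := congrArg (· % Fintype.card V) huv
    simp only [Nat.add_mul_mod_self_left, Nat.mod_eq_of_lt (i _).2] at this
    exact i.injective (Fin.ext this)
  · have h1 := (i u).2
    have h2 := Nat.mul_le_mul_left (Fintype.card V) (Nat.succ_le_of_lt (hr u v huv))
    rw [Nat.mul_succ] at h2
    show (i u : ℕ) + Fintype.card V * r u < i v + Fintype.card V * r v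
    omega

omit [DecidableEq V] in
theorem exists_isFeedbackArcSet_card_eq_fas [Fintype V] (D : Digraph V) :
    ∃ F : Finset (V × V), D.IsFeedbackArcSet F ∧ F.card = D.fas := by
  classical
  refine Nat.sInf_mem (s := {m : ℕ | ∃ F : Finset (V × V), D.IsFeedbackArcSet F ∧ F.card = m})
    ⟨_, Finset.univ.filter fun q : V × V => D.Adj q.1 q.2, ⟨fun e he => ?_, ?_⟩, rfl⟩
  · exact (Finset.mem_filter.1 he).2
  · exact isAcyclic_of_lt (fun _ => 0) fun u v huv =>
      absurd (by simpa using huv.1) huv.2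

/-- An oriented graph becomes acyclic by reversing the backward arcs of a suitable vertex
ordering. -/
theorem exists_backward_edges [Fintype V] {D : Digraph V} (hD : D.IsOriented) :
    ∃ (key : V → ℕ) (B : Finset (Sym2 V)), Function.Injective key ∧ B.card ≤ D.fas ∧
      (∀ e ∈ B, ¬ e.IsDiag) ∧
      ∀ u v, (if s(u, v) ∈ B then D.Adj v u else D.Adj u v) → key u < key v := by
  classical
  obtain ⟨F, hF, hFc⟩ := exists_isFeedbackArcSet_card_eq_fas D
  obtain ⟨key, hinj, hkey⟩ := exists_injective_key hF.2
  -- Arcs outside `F` go forward in the order, so the backward arcs lie in `F`. Reversing them,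
  -- instead of deleting `F`, leaves only forward arcs.
  let A := Finset.univ.filter fun q : V × V => D.Adj q.1 q.2 ∧ key q.2 < key q.1
  have hA : A ⊆ F := by
    rintro ⟨u, v⟩ hq
    obtain ⟨-, h1, h2⟩ := Finset.mem_filter.1 hq
    by_contra h
    exact lt_asymm h2 (hkey u v ⟨h1, h⟩)
  have hmem : ∀ u v, s(u, v) ∈ A.image Sym2.mk.uncurry ↔
      (D.Adj u v ∧ key v < key u) ∨ (D.Adj v u ∧ key u < key v) := by
    intro u v
    simp only [A, Finset.mem_image, Finset.mem_filter, Finset.mem_univ, true_and, Prod.exists,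
      Function.uncurry, Sym2.eq_iff]
    constructor
    · rintro ⟨a, b, h, ⟨rfl, rfl⟩ | ⟨rfl, rfl⟩⟩
      exacts [Or.inl h, Or.inr h]
    · rintro (h | h)
      exacts [⟨u, v, h, Or.inl ⟨rfl, rfl⟩⟩, ⟨v, u, h, Or.inr ⟨rfl, rfl⟩⟩]
  refine ⟨key, A.image Sym2.mk.uncurry, hinj,
    hFc ▸ Finset.card_image_le.trans (Finset.card_le_card hA), fun e he hd => ?_, fun u v h => ?_⟩
  · induction e using Sym2.ind with | _ a b
    have hab : a = b := by simpa using hd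
    subst hab
    rw [hmem] at he
    rcases he with h | h <;> exact lt_irrefl _ h.2
  · have hne : u ≠ v := by
      rintro rfl
      have : D.Adj u u := by simpa using h
      exact hD u u this this
    rcases lt_or_gt_of_ne (hinj.ne hne) with hlt | hlt
    · exact hlt
    · by_cases hm : s(u, v) ∈ A.image Sym2.mk.uncurry
      · rw [if_pos hm] at h
        rcases (hmem u v).1 hm with h' | h'
        exacts [absurd h (hD _ _ h'.1), h'.2]
      · rw [if_neg hm] at h
        exact absurd ((hmem u v).2 (Or.inl ⟨h, hlt⟩)) hm

/-- An even set of at most `fas D + 1` pairs of vertices whose reversal makes `D` acyclic. -/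
theorem exists_even_reversal [Fintype V] {D : Digraph V} (hD : D.IsOriented)
    (hV : 2 ≤ Fintype.card V) :
    ∃ F : Finset (Sym2 V), (∀ e ∈ F, ¬ e.IsDiag) ∧ Even F.card ∧ F.card ≤ D.fas + 1 ∧
      ∀ L : List (Finset V),
        (∀ u v, u ≠ v → (L.map fun X => chi X u * chi X v).sum = edgeInd F u v) →
          (D.invertFamily L).IsAcyclic := by
  obtain ⟨key, B, hinj, hBc, hBd, hB⟩ := exists_backward_edges hD
  have hadj : ∀ (F : Finset (Sym2 V)) (L : List (Finset V)),
      (∀ u v, u ≠ v → (L.map fun X => chi X u * chi X v).sum = edgeInd F u v) →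
      ∀ u v, (D.invertFamily L).Adj u v →
        u ≠ v ∧ if s(u, v) ∈ F then D.Adj v u else D.Adj u v := by
    intro F L hL u v h
    rw [invertFamily_adj] at h
    have hne : u ≠ v := by
      rintro rfl
      have : D.Adj u u := by simpa using h
      exact hD u u this this
    refine ⟨hne, ?_⟩
    rw [hL u v hne] at h
    by_cases hm : s(u, v) ∈ F <;> simpa [edgeInd, hm] using h
  by_cases hev : Even B.card
  · exact ⟨B, hBd, hev, by omega, fun L hL => isAcyclic_of_lt key fun u v h =>
      hB u v (hadj B L hL u v h).2⟩
  have hne : (Finset.univ : Finset V).Nonempty := by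
    rw [← Finset.card_pos, Finset.card_univ]; omega
  -- Toggling the pair of the two first vertices `a`, `b` corrects the parity, whether or not they
  -- are adjacent.
  obtain ⟨a, -, ha⟩ := Finset.exists_min_image Finset.univ key hne
  have hne' : (Finset.univ.erase a).Nonempty := by
    rw [← Finset.card_pos, Finset.card_erase_of_mem (Finset.mem_univ a), Finset.card_univ]; omega
  obtain ⟨b, hb, hb'⟩ := Finset.exists_min_image (Finset.univ.erase a) key hne'
  have hba : b ≠ a := Finset.ne_of_mem_erase hb
  have hab : key a < key b := lt_of_le_of_ne (ha b (Finset.mem_univ b)) (hinj.ne hba.symm)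
  have hmin : ∀ v, v ≠ a → v ≠ b → key b < key v := fun v hva hvb =>
    lt_of_le_of_ne (hb' v (by simp [hva])) (hinj.ne hvb.symm)
  let F := if s(a, b) ∈ B then B.erase s(a, b) else insert s(a, b) B
  have hFcard : F.card = B.card + 1 ∨ F.card + 1 = B.card := by
    by_cases h : s(a, b) ∈ B
    · right; simpa [F, h] using Finset.card_erase_add_one h
    · left; simp [F, h]
  have hFsame : ∀ u v, s(u, v) ≠ s(a, b) → (s(u, v) ∈ F ↔ s(u, v) ∈ B) := by
    intro u v h
    by_cases h' : s(a, b) ∈ B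
    · rw [show F = B.erase s(a, b) from if_pos h']; simp only [Finset.mem_erase, h, ne_eq,
        not_false_eq_true, true_and]
    · rw [show F = insert s(a, b) B from if_neg h']; simp only [Finset.mem_insert, h, false_or]
  have hFdiff : s(a, b) ∈ F ↔ s(a, b) ∉ B := by
    by_cases h' : s(a, b) ∈ B <;> simp [F, h']
  refine ⟨F, fun e he => ?_, ?_, by omega, fun L hL => ?_⟩
  · by_cases h : e = s(a, b)
    · subst h; simpa using hba.symm
    · induction e using Sym2.ind with | _ u v
      exact hBd _ ((hFsame u v h).1 he)
  · rw [Nat.not_even_iff_odd] at hev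
    rcases hFcard with h | h
    · rw [h]; exact hev.add_one
    · rw [← h, Nat.odd_add_one, Nat.not_odd_iff_even] at hev; exact hev
  -- Exchanging `a` and `b` affects no other comparison, as every other vertex comes after both.
  · refine isAcyclic_of_lt (fun x => if x = a then key b else if x = b then key a else key x)
      fun u v h => ?_
    obtain ⟨huv, h⟩ := hadj F L hL u v h
    by_cases hs : s(u, v) = s(a, b)
    · rcases Sym2.eq_iff.1 hs with ⟨rfl, rfl⟩ | ⟨rfl, rfl⟩
      · refine absurd (hB v u ?_) hab.asymm
        rw [Sym2.eq_swap]
        by_cases hm : s(u, v) ∈ B <;> simpa [hFdiff, hm] using h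
      · simpa [huv] using hab
    · simp only [hFsame u v hs] at h
      have hlt := hB u v h
      have hva : v ≠ a := by
        rintro rfl
        exact absurd (ha u (Finset.mem_univ u)) (not_le.2 hlt)
      have hvb : v ≠ b := by
        rintro rfl
        have hua : u ≠ a := by rintro rfl; exact hs rfl
        exact absurd (hmin u hua huv) hlt.asymm
      have := hmin v hva hvb
      simp only [hva, hvb, if_false]
      split_ifs <;> omega

theorem eqInvNumber_le {D : Digraph V} {F : Finset (Sym2 V)} {p m : ℕ}
    (hF : ∀ L : List (Finset V),
      (∀ u v, u ≠ v → (L.map fun X => chi X u * chi X v).sum = edgeInd F u v) →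
        (D.invertFamily L).IsAcyclic)
    (h : Realizes p (edgeInd F) m) : D.eqInvNumber p ≤ m := by
  obtain ⟨L, hL, hl, hs⟩ := h
  exact (iInf₂_le L ⟨hL, hF L hs⟩).trans (by exact_mod_cast hl)

end Acyclicity

/-! ### Packing balanced complete bipartite graphs. -/

section Bipartite

variable {V : Type u} [DecidableEq V]

/-- The edges between two sets of vertices. -/
def edgesBetween (A B : Finset V) : Finset (Sym2 V) := (A ×ˢ B).image Sym2.mk.uncurry

theorem mem_edgesBetween {A B : Finset V} {u v : V} :
    s(u, v) ∈ edgesBetween A B ↔ (u ∈ A ∧ v ∈ B) ∨ (v ∈ A ∧ u ∈ B) := by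
  simp only [edgesBetween, Finset.mem_image, Finset.mem_product, Prod.exists, Function.uncurry,
    Sym2.eq_iff]
  constructor
  · rintro ⟨a, b, h, ⟨rfl, rfl⟩ | ⟨rfl, rfl⟩⟩
    exacts [Or.inl h, Or.inr h]
  · rintro (h | h)
    exacts [⟨u, v, h, Or.inl ⟨rfl, rfl⟩⟩, ⟨v, u, h, Or.inr ⟨rfl, rfl⟩⟩]

theorem card_edgesBetween {A B : Finset V} (h : Disjoint A B) :
    (edgesBetween A B).card = A.card * B.card := by
  rw [edgesBetween, Finset.card_image_of_injOn, Finset.card_product]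
  rintro ⟨a, b⟩ hab ⟨c, d⟩ hcd he
  simp only [Finset.coe_product, Set.mem_prod, Finset.mem_coe] at hab hcd
  rcases Sym2.eq_iff.1 he with ⟨rfl, rfl⟩ | ⟨rfl, rfl⟩
  · rfl
  · exact absurd hcd.2 (Finset.disjoint_left.1 h hab.1)

theorem edgeInd_edgesBetween {A B : Finset V} (h : Disjoint A B) :
    edgeInd (edgesBetween A B) = wedge (chi A) (chi B) := by
  ext u v
  have hu : u ∈ A → u ∉ B := fun h' => Finset.disjoint_left.1 h h'
  have hv : v ∈ A → v ∉ B := fun h' => Finset.disjoint_left.1 h h'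
  simp only [edgeInd, mem_edgesBetween, wedge, chi]
  by_cases h1 : u ∈ A <;> by_cases h2 : v ∈ A <;> by_cases h3 : u ∈ B <;> by_cases h4 : v ∈ B <;>
    simp_all

/-- A balanced complete bipartite graph with parts of even size `p` is reversed by four
inversions. -/
theorem realizes_edgesBetween {p : ℕ} (hpe : Even p) {A B : Finset V} (h : Disjoint A B)
    (hA : A.card = p) (hB : B.card = p) : Realizes p (edgeInd (edgesBetween A B)) 4 := by
  obtain ⟨q, rfl⟩ := hpe
  have split : ∀ {S : Finset V}, S.card = q + q → ∃ X Y : Finset V, X.card = q ∧ Y.card = q ∧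
      Disjoint X Y ∧ X ∪ Y = S := by
    intro S hS
    obtain ⟨X, hX, hc⟩ := Finset.exists_subset_card_eq (s := S) (n := q) (by omega)
    exact ⟨X, S \ X, hc, by rw [Finset.card_sdiff_of_subset hX]; omega, Finset.disjoint_sdiff,
      Finset.union_sdiff_of_subset hX⟩
  obtain ⟨A₁, A₂, hA₁, hA₂, hA', rfl⟩ := split hA
  obtain ⟨B₁, B₂, hB₁, hB₂, hB', rfl⟩ := split hB
  rw [edgeInd_edgesBetween h]
  simp only [Finset.disjoint_union_left, Finset.disjoint_union_right] at h
  have key : ∀ {X Y : Finset V}, X.card = q → Y.card = q → Disjoint X Y → Realizes (q + q)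
      (fun u v => (chi X u + chi Y u) * (chi X v + chi Y v)) 1 := by
    intro X Y hX hY hd
    refine (Realizes.clique (X := X ∪ Y) ?_).congr le_rfl fun u v _ => ?_
    · rw [Finset.card_union_of_disjoint hd, hX, hY]
    · rw [chi_union hd, chi_union hd]
  -- With cliques on the four unions `Aᵢ ∪ Bⱼ`, pairs inside a half are covered twice and pairs
  -- between `A` and `B` once.
  refine ((((key hA₁ hB₁ h.1.1).add (key hA₁ hB₂ h.2.1)).add (key hA₂ hB₁ h.1.2)).add
    (key hA₂ hB₂ h.2.2)).congr le_rfl fun u v _ => ?_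
  simp only [Pi.add_apply, wedge, chi_union hA', chi_union hB']
  linear_combination (chi A₁ u * chi A₁ v + chi A₂ u * chi A₂ v + chi B₁ u * chi B₁ v +
    chi B₂ u * chi B₂ v) * two_eq_zero

/-- Greedy packing of balanced complete bipartite graphs into a set of edges. -/
theorem exists_packing {p : ℕ} (hp : 0 < p) (hpe : Even p) (F : Finset (Sym2 V)) :
    ∃ R ⊆ F, (∀ A B : Finset V, Disjoint A B → A.card = p → B.card = p →
        ¬ edgesBetween A B ⊆ R) ∧
      ∃ k, F.card = R.card + k * p ^ 2 ∧ Realizes p (edgeInd F + edgeInd R) (4 * k) := by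
  induction F using Finset.strongInduction with
  | H F ih =>
    by_cases hfree : ∀ A B : Finset V, Disjoint A B → A.card = p → B.card = p →
        ¬ edgesBetween A B ⊆ F
    · refine ⟨F, subset_rfl, hfree, 0, by simp, (Realizes.zero p).congr (by simp)
        fun u v _ => ?_⟩
      exact (CharTwo.add_self_eq_zero _).symm
    push Not at hfree
    obtain ⟨A, B, hd, hA, hB, hsub⟩ := hfree
    have hcard : (edgesBetween A B).card = p ^ 2 := by
      rw [card_edgesBetween hd, hA, hB, sq]
    have hne : (edgesBetween A B).Nonempty := by
      rw [← Finset.card_pos, hcard]; positivity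
    obtain ⟨R, hR, hRf, k, hk, hr⟩ := ih (F \ edgesBetween A B) (Finset.sdiff_ssubset hsub hne)
    refine ⟨R, hR.trans Finset.sdiff_subset, hRf, k + 1, ?_, ?_⟩
    · rw [← Finset.card_sdiff_add_card_eq_card hsub, hk, hcard]; ring
    · refine (hr.add (realizes_edgesBetween hpe hd hA hB)).congr (by omega) fun u v _ => ?_
      conv_rhs => rw [← Finset.sdiff_union_of_subset hsub, edgeInd_union Finset.sdiff_disjoint]
      simp only [Pi.add_apply]
      ring

/-- The Kővári–Sós–Turán bound. -/
theorem card_le_of_edgesBetween_free [Fintype V] {p : ℕ} (hp : 0 < p) (R : Finset (Sym2 V))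
    (hdiag : ∀ e ∈ R, ¬ e.IsDiag) (hfree : ∀ A B : Finset V, Disjoint A B → A.card = p →
      B.card = p → ¬ edgesBetween A B ⊆ R) :
    ∃ S : ℕ, R.card ≤ S + p * Fintype.card V ∧
      S ^ p ≤ p.factorial * p * Fintype.card V ^ (2 * p - 1) := by
  let N : V → Finset V := fun v => Finset.univ.filter fun u => s(v, u) ∈ R
  -- Count pairs of a vertex `v` and a `p`-set `T ⊆ N v`: more than `p` common neighbours of `T`
  -- would yield a forbidden bipartite graph.
  have hcount : ∑ v, (N v).card.choose p ≤ p * Fintype.card V ^ p := by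
    have h1 : ∀ v, (N v).card.choose p =
        ((Finset.univ.powersetCard p).filter fun T => T ⊆ N v).card := by
      intro v
      rw [← Finset.card_powersetCard]
      congr 1
      ext T
      simp [Finset.mem_powersetCard, and_comm]
    simp only [h1]
    have h2 := Finset.sum_card_bipartiteAbove_eq_sum_card_bipartiteBelow (s := Finset.univ)
      (t := (Finset.univ : Finset V).powersetCard p) fun v T => T ⊆ N v
    simp only [Finset.bipartiteAbove, Finset.bipartiteBelow] at h2
    rw [h2]
    calc ∑ T ∈ (Finset.univ : Finset V).powersetCard p,
          (Finset.univ.filter fun v => T ⊆ N v).card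
        ≤ ∑ T ∈ (Finset.univ : Finset V).powersetCard p, p := by
          refine Finset.sum_le_sum fun T hT => ?_
          by_contra! hlt
          obtain ⟨A, hA, hAc⟩ := Finset.exists_subset_card_eq hlt.le
          have hAT : ∀ a ∈ A, ∀ t ∈ T, s(a, t) ∈ R := fun a ha t ht =>
            (Finset.mem_filter.1 ((Finset.mem_filter.1 (hA ha)).2 ht)).2
          refine hfree A T (Finset.disjoint_left.2 fun x hx hx' => ?_) hAc
            (Finset.mem_powersetCard.1 hT).2 fun e he => ?_
          · exact hdiag _ (hAT x hx x hx') (by simp)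
          · induction e using Sym2.ind with | _ u v
            rcases mem_edgesBetween.1 he with h | h
            · exact hAT u h.1 v h.2
            · rw [Sym2.eq_swap]; exact hAT v h.1 u h.2
      _ = (Fintype.card V).choose p * p := by simp
      _ ≤ p * Fintype.card V ^ p := by
          rw [mul_comm]; exact Nat.mul_le_mul_left p (Nat.choose_le_pow _ _)
  -- The truncated difference drops at most `p` per vertex and vanishes for degrees below `p`; its
  -- `p`-th power is at most `p!` times the binomial coefficient. The power mean inequality then
  -- bounds the sum.
  refine ⟨∑ v, ((N v).card + 1 - p), ?_, ?_⟩
  · have h1 : R ⊆ Finset.univ.biUnion fun v => (N v).image fun u => s(v, u) := by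
      intro e he
      induction e using Sym2.ind with | _ a b
      exact Finset.mem_biUnion.2 ⟨a, Finset.mem_univ a, Finset.mem_image.2
        ⟨b, Finset.mem_filter.2 ⟨Finset.mem_univ b, he⟩, rfl⟩⟩
    calc R.card ≤ ∑ v, ((N v).image fun u => s(v, u)).card :=
          (Finset.card_le_card h1).trans Finset.card_biUnion_le
      _ ≤ ∑ v, (((N v).card + 1 - p) + p) := Finset.sum_le_sum fun v _ =>
          Finset.card_image_le.trans (by omega)
      _ = _ := by rw [Finset.sum_add_distrib]; simp [mul_comm]
  · obtain ⟨q, rfl⟩ : ∃ q, p = q + 1 := ⟨p - 1, by omega⟩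
    have h1 : (∑ v, ((N v).card + 1 - (q + 1))) ^ (q + 1) ≤
        (Fintype.card V) ^ q * ∑ v, ((N v).card + 1 - (q + 1)) ^ (q + 1) := by
      simpa using pow_sum_le_card_mul_sum_pow (s := Finset.univ)
        (f := fun v => (N v).card + 1 - (q + 1)) (fun _ _ => Nat.zero_le _) q
    refine h1.trans ?_
    have h2 : ∑ v, ((N v).card + 1 - (q + 1)) ^ (q + 1) ≤
        (q + 1).factorial * ∑ v, (N v).card.choose (q + 1) := by
      rw [Finset.mul_sum]
      exact Finset.sum_le_sum fun v _ => by
        have := Nat.pow_le_choose (α := ℚ) (q + 1) (N v).card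
        rw [div_le_iff₀' (by positivity)] at this
        exact_mod_cast this
    calc (Fintype.card V) ^ q * ∑ v, ((N v).card + 1 - (q + 1)) ^ (q + 1)
        ≤ (Fintype.card V) ^ q * ((q + 1).factorial * ((q + 1) * Fintype.card V ^ (q + 1))) :=
          Nat.mul_le_mul_left _ (h2.trans (Nat.mul_le_mul_left _ hcount))
      _ = _ := by
          rw [show 2 * (q + 1) - 1 = q + (q + 1) by omega, pow_add]; ring

end Bipartite

/-! ### Two inversions, then one inversion, per edge. -/

section EdgeSets

variable {V : Type u} [DecidableEq V] [Fintype V] {p : ℕ}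

/-- The edges at a vertex form a star. -/
theorem exists_star_eq (F : Finset (Sym2 V)) (hdiag : ∀ e ∈ F, ¬ e.IsDiag) (w : V) :
    ∃ c : V → ZMod 2, c w = 0 ∧ ∑ v, c v = (F.filter fun e => w ∈ e).card ∧
      ∀ u v, u ≠ v → edgeInd (F.filter fun e => w ∈ e) u v = wedge (chi {w}) c u v := by
  let S := Finset.univ.filter fun v => s(w, v) ∈ F
  have hww : s(w, w) ∉ F := fun h => hdiag _ h (by simp)
  refine ⟨chi S, by simp [chi, S, hww], ?_, fun u v huv => ?_⟩
  · have h : (F.filter fun e => w ∈ e) = S.image fun v => s(w, v) := by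
      ext e
      simp only [Finset.mem_filter, Finset.mem_image, Finset.mem_univ, true_and, S]
      constructor
      · rintro ⟨he, hw⟩
        obtain ⟨x, rfl⟩ := Sym2.mem_iff_exists.1 hw
        exact ⟨x, he, rfl⟩
      · rintro ⟨x, hx, rfl⟩
        exact ⟨hx, by simp⟩
    rw [sum_chi, h, Finset.card_image_of_injective _ fun x y hxy => Sym2.congr_right.1 hxy]
  · simp only [edgeInd, wedge, chi, S, Finset.mem_filter, Finset.mem_univ, true_and,
      Finset.mem_singleton, Sym2.mem_iff]
    by_cases h1 : u = w
    · subst h1; simp [huv.symm]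
    · by_cases h2 : v = w
      · subst h2; simp [h1, Sym2.eq_swap]
      · simp [h1, h2, Ne.symm h1, Ne.symm h2]

/-- Any even set of edges is reversed by two inversions per edge, up to a term linear in the
order. -/
theorem realizes_edgeInd_two_mul (hp : 2 ≤ p) (hpe : Even p) (hn : p + 2 ≤ Fintype.card V)
    (F : Finset (Sym2 V)) (hF : Even F.card) (hdiag : ∀ e ∈ F, ¬ e.IsDiag) :
    Realizes p (edgeInd F) (2 * F.card + (2 * p - 2) * (Fintype.card V - 1)) := by
  obtain ⟨w⟩ : Nonempty V := Fintype.card_pos_iff.1 (by omega)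
  obtain ⟨c, hcw, hc, hs⟩ := exists_star_eq F hdiag w
  have hsplit := Finset.card_filter_add_card_filter_not (s := F) fun e => w ∈ e
  have hpar : ((F.filter fun e => w ∈ e).card : ZMod 2) = (F.filter fun e => w ∉ e).card := by
    have h := (ZMod.natCast_eq_zero_iff_even).2 hF
    rw [← hsplit, Nat.cast_add] at h
    linear_combination h - ((F.filter fun e => w ∉ e).card : ZMod 2) * two_eq_zero
  refine (realizes_edgeInd_add_star hp hpe hn w (F.filter fun e => w ∉ e)
    (fun e he => hdiag e (Finset.mem_filter.1 he).1) (fun e he => (Finset.mem_filter.1 he).2)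
    c hcw (hc.trans hpar)).congr (by gcongr; exact Finset.filter_subset _ _) fun u v huv => ?_
  conv_rhs => rw [← Finset.filter_union_filter_not_eq (fun e => w ∈ e) F,
    edgeInd_union (Finset.disjoint_filter_filter_not _ _ _)]
  simp only [Pi.add_apply, hs u v huv]
  ring

theorem card_filter_meets_le (F : Finset (Sym2 V)) (Z : Finset V) :
    (F.filter fun e => ∃ x ∈ Z, x ∈ e).card ≤ Z.card * Fintype.card V := by
  rw [← Finset.card_univ, ← Finset.card_product]
  refine (Finset.card_le_card (t := (Z ×ˢ Finset.univ).image Sym2.mk.uncurry)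
    fun e he => ?_).trans Finset.card_image_le
  obtain ⟨-, x, hx, hxe⟩ := Finset.mem_filter.1 he
  obtain ⟨y, rfl⟩ := Sym2.mem_iff_exists.1 hxe
  exact Finset.mem_image.2 ⟨(x, y), by simp [hx], rfl⟩

theorem exists_even_subset {α : Type*} (F : Finset α) :
    ∃ H ⊆ F, Even H.card ∧ F.card ≤ H.card + 1 := by
  obtain ⟨H, hH, hc⟩ := Finset.exists_subset_card_eq (s := F) (n := 2 * (F.card / 2)) (by omega)
  exact ⟨H, hH, hc ▸ even_two_mul _, by omega⟩

/-- Any even set of edges is reversed by one inversion per edge, up to a term linear in the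
order. -/
theorem realizes_edgeInd_one_mul (hp : 2 ≤ p) (hpe : Even p) (hn : p + 2 ≤ Fintype.card V)
    (F : Finset (Sym2 V)) (hF : Even F.card) (hdiag : ∀ e ∈ F, ¬ e.IsDiag) :
    Realizes p (edgeInd F)
      (F.card + 1 + (p - 1) * Fintype.card V + (2 * p - 2) * (Fintype.card V - 1)) := by
  obtain ⟨w⟩ : Nonempty V := Fintype.card_pos_iff.1 (by omega)
  obtain ⟨c, hcw, hc, hs⟩ := exists_star_eq F hdiag w
  obtain ⟨Z, hZ, hZw⟩ := exists_card_eq_disjoint (m := p - 2) ({w} : Finset V) (by simp; omega)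
  have hwZ : w ∉ Z := fun h => Finset.disjoint_left.1 hZw h (by simp)
  set G := F.filter fun e => w ∉ e with hG
  -- Edges of `H` cost one inversion each. At most `(p - 2)n + 1` edges of `G` lie outside `H`, so
  -- paying two for each of those adds only a linear term.
  obtain ⟨H, hHs, hHe, hHc⟩ := exists_even_subset (G.filter fun e => ¬ ∃ x ∈ Z, x ∈ e)
  have hHG : H ⊆ G := hHs.trans (Finset.filter_subset _ _)
  have hGd : ∀ e ∈ G, ¬ e.IsDiag := fun e he => hdiag e (Finset.mem_filter.1 he).1
  have hGw : ∀ e ∈ G, w ∉ e := fun e he => (Finset.mem_filter.1 he).2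
  have hsplit : (F.filter fun e => w ∈ e).card + G.card = F.card :=
    Finset.card_filter_add_card_filter_not (s := F) fun e => w ∈ e
  have hRH : (G \ H).card + H.card = G.card := Finset.card_sdiff_add_card_eq_card hHG
  have hGsplit := Finset.card_filter_add_card_filter_not (s := G) fun e => ∃ x ∈ Z, x ∈ e
  have hmeet := card_filter_meets_le G Z
  have hpar : ((F.filter fun e => w ∈ e).card : ZMod 2) = (G \ H).card := by
    have h := (ZMod.natCast_eq_zero_iff_even).2 hF
    have h' := (ZMod.natCast_eq_zero_iff_even).2 hHe
    rw [← hsplit, ← hRH, Nat.cast_add, Nat.cast_add, h'] at h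
    linear_combination h - ((G \ H).card : ZMod 2) * two_eq_zero
  have r1 := realizes_of_avoids hp hZ hwZ H hHe (fun e he => hGd e (hHG he))
    (fun e he => hGw e (hHG he))
    (fun e he x hx hxe => (Finset.mem_filter.1 (hHs he)).2 ⟨x, hx, hxe⟩)
  have r2 := realizes_edgeInd_add_star hp hpe hn w (G \ H)
    (fun e he => hGd e (Finset.sdiff_subset he)) (fun e he => hGw e (Finset.sdiff_subset he))
    -- The star left over from `H` is merged with the edges of `F` at `w`.
    (c + degreeParity H)
    (by simp [hcw, degreeParity_eq_zero fun e he => hGw e (hHG he)])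
    (by simp only [Pi.add_apply, Finset.sum_add_distrib, hc,
          sum_degreeParity H fun e he => hGd e (hHG he), add_zero, hpar])
  refine (r1.add r2).congr ?_ fun u v huv => ?_
  · obtain ⟨q, rfl⟩ : ∃ q, p = q + 2 := ⟨p - 2, by omega⟩
    rw [hZ] at hmeet
    simp only [Nat.add_sub_cancel, show q + 2 - 1 = q + 1 by omega, add_mul, one_mul] at hmeet ⊢
    omega
  · conv_rhs => rw [← Finset.filter_union_filter_not_eq (fun e => w ∈ e) F,
      edgeInd_union (Finset.disjoint_filter_filter_not _ _ _), ← hG,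
      ← Finset.sdiff_union_of_subset hHG, edgeInd_union Finset.sdiff_disjoint]
    simp only [Pi.add_apply, hs u v huv, wedge]
    linear_combination (chi {w} u * degreeParity H v + degreeParity H u * chi {w} v) * two_eq_zero

end EdgeSets

/-! ### The error term in (iv). -/

section Asymptotic

/-- For `n > 0`, the quotient by `n²` is a constant times `n^(-1/p)`. -/
theorem isLittleO_kst (p : ℕ) (hp : 0 < p) (C : ℝ) (hC : 0 ≤ C) :
    (fun n : ℕ => (C * (n : ℝ) ^ (2 * p - 1)) ^ (1 / (p : ℝ))) =o[atTop]
      fun n : ℕ => (n : ℝ) ^ 2 := by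
  have hp' : (0 : ℝ) < p := by exact_mod_cast hp
  have h : Tendsto (fun n : ℕ => C ^ (1 / (p : ℝ)) * (n : ℝ) ^ (-(1 / (p : ℝ)))) atTop (nhds 0) := by
    simpa using ((tendsto_rpow_neg_atTop (y := 1 / (p : ℝ)) (by positivity)).comp
      tendsto_natCast_atTop_atTop).const_mul (C ^ (1 / (p : ℝ)))
  refine (isLittleO_iff_tendsto' ?_).2 (h.congr' ?_)
  · filter_upwards [eventually_gt_atTop 0] with n hn h0
    have : (n : ℝ) ≠ 0 := by positivity
    simp_all
  · filter_upwards [eventually_gt_atTop 0] with n hn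
    have hn' : (0 : ℝ) < n := by exact_mod_cast hn
    rw [Real.mul_rpow hC (by positivity), mul_div_assoc, ← Real.rpow_natCast, ← Real.rpow_natCast,
      ← Real.rpow_mul hn'.le, ← Real.rpow_sub hn']
    congr 2
    rw [Nat.cast_sub (by omega)]
    push_cast
    field_simp
    ring

end Asymptotic

end EqInversion

/-! ### Assembly of the four bounds. -/

open EqInversion in
theorem theorem5 (p : ℕ) (hp : 4 ≤ p) (hp_even : Even p) :
    (∀ (V : Type u) [Fintype V] (D : Digraph V), D.IsOriented → p + 2 ≤ Fintype.card V →
      -- (i)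
      D.eqInvNumber p ≤ (((2 * p - 2) * (D.fas + 1) : ℕ) : ℕ∞) ∧
      -- (ii)
      D.eqInvNumber p ≤ ((2 * D.fas + 2 * p * Fintype.card V : ℕ) : ℕ∞) ∧
      -- (iii)
      (∀ k : ℕ, 1 ≤ k → p + 2 * k ≤ Fintype.card V + 2 →
        ∃ m : ℕ, D.eqInvNumber p = (m : ℕ∞) ∧
          (m : ℝ) ≤ (D.fas : ℝ)
            + ((p : ℝ) - 2) / 2 * (Fintype.card V : ℝ) ^ (1 + 1 / (k : ℝ))
            + (((p : ℝ) - 2) * (2 : ℝ) ^ (k ^ 2) + ((p : ℝ) - 1) / 2) * (Fintype.card V : ℝ)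
            + 1)) ∧
    -- (iv)
    (∃ g : ℕ → ℝ, g =o[atTop] (fun n : ℕ => (n : ℝ) ^ 2) ∧
      ∀ (V : Type u) [Fintype V] (D : Digraph V), D.IsOriented → p + 2 ≤ Fintype.card V →
        ∃ m : ℕ, D.eqInvNumber p = (m : ℕ∞) ∧
          (m : ℝ) ≤ (D.fas : ℝ) / ((⌈(p : ℝ) / 2⌉₊ : ℝ) * (⌊(p : ℝ) / 2⌋₊ : ℝ))
            + g (Fintype.card V)) := by
  classical
  have hp2 : 2 ≤ p := by omega
  have of_le : ∀ {x : ℕ∞} {a : ℕ} {b : ℝ}, x ≤ a → (a : ℝ) ≤ b →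
      ∃ m : ℕ, x = (m : ℕ∞) ∧ (m : ℝ) ≤ b := by
    intro x a b hx hab
    obtain ⟨m, rfl⟩ := ENat.ne_top_iff_exists.1 (ne_top_of_le_ne_top (ENat.natCast_ne_top a) hx)
    exact ⟨m, rfl, le_trans (by exact_mod_cast hx) hab⟩
  refine ⟨fun V _ D hD hn => ?_, ?_⟩
  · obtain ⟨F, hdiag, hF, hFc, hacyc⟩ := exists_even_reversal hD (by omega)
    refine ⟨?_, ?_, fun k hk _ => ?_⟩
    · refine (eqInvNumber_le hacyc (realizes_edgeInd hp2 hp_even hn F hF hdiag)).trans ?_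
      exact_mod_cast Nat.mul_le_mul_left _ hFc
    · refine (eqInvNumber_le hacyc (realizes_edgeInd_two_mul hp2 hp_even hn F hF hdiag)).trans ?_
      rw [Nat.cast_le]
      obtain ⟨q, rfl⟩ : ∃ q, p = q + 2 := ⟨p - 2, by omega⟩
      obtain ⟨r, hr⟩ : ∃ r, Fintype.card V = r + 1 := ⟨Fintype.card V - 1, by omega⟩
      rw [hr, Nat.add_sub_cancel, show 2 * (q + 2) - 2 = 2 * q + 2 by omega]
      nlinarith
    · have h := eqInvNumber_le hacyc (realizes_edgeInd_one_mul hp2 hp_even hn F hF hdiag)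
      refine of_le (a := D.fas + 3 * (p - 1) * Fintype.card V) (h.trans ?_) ?_
      · rw [Nat.cast_le]
        obtain ⟨q, rfl⟩ : ∃ q, p = q + 2 := ⟨p - 2, by omega⟩
        obtain ⟨r, hr⟩ : ∃ r, Fintype.card V = r + 1 := ⟨Fintype.card V - 1, by omega⟩
        rw [hr, Nat.add_sub_cancel, show 2 * (q + 2) - 2 = 2 * q + 2 by omega,
          show q + 2 - 1 = q + 1 by omega]
        nlinarith
      · have hpR : (4 : ℝ) ≤ p := by exact_mod_cast hp
        have hnR : (6 : ℝ) ≤ Fintype.card V := by exact_mod_cast (by omega : 6 ≤ Fintype.card V)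
        push_cast [Nat.cast_sub (by omega : 1 ≤ p)]
        set n : ℝ := (Fintype.card V : ℝ)
        have hlin : 3 * ((p : ℝ) - 1) * n ≤ (5 * ((p : ℝ) - 2) + ((p : ℝ) - 1) / 2) * n :=
          mul_le_mul_of_nonneg_right (by linarith) (by linarith)
        -- The linear bound needs a coefficient of `5(p - 2)` beside `(p - 1)/2`. For `k = 1` it is
        -- `3(p - 2)` from `n² ≥ 6n` plus `2(p - 2)`; for `k ≥ 2`, `2^(k²) ≥ 16` suffices.
        rcases hk.eq_or_lt with rfl | hk
        · have e : n ^ (1 + 1 / ((1 : ℕ) : ℝ)) = n * n := by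
            rw [show (1 + 1 / ((1 : ℕ) : ℝ)) = ((2 : ℕ) : ℝ) by norm_num, Real.rpow_natCast, sq]
          rw [e]
          have h6 : ((p : ℝ) - 2) / 2 * (6 * n) ≤ ((p : ℝ) - 2) / 2 * (n * n) := by
            have : 0 ≤ ((p : ℝ) - 2) / 2 := by linarith
            gcongr
          norm_num
          linarith
        · have h0 : 0 ≤ ((p : ℝ) - 2) / 2 * n ^ (1 + 1 / (k : ℝ)) :=
            mul_nonneg (by linarith) (Real.rpow_nonneg (by linarith) _)
          have h16 : (16 : ℝ) ≤ 2 ^ (k ^ 2) := by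
            calc (16 : ℝ) = 2 ^ 4 := by norm_num
              _ ≤ 2 ^ (k ^ 2) := pow_le_pow_right₀ (by norm_num) (by nlinarith)
          have h1 : (5 * ((p : ℝ) - 2) + ((p : ℝ) - 1) / 2) * n ≤
              (((p : ℝ) - 2) * (2 : ℝ) ^ (k ^ 2) + ((p : ℝ) - 1) / 2) * n := by
            refine mul_le_mul_of_nonneg_right ?_ (by linarith)
            nlinarith
          linarith
  · set C : ℝ := p.factorial * p
    -- The constant `4 / p²` pays for the `+ 1` in `F.card ≤ D.fas + 1`; the rest is `2p - 2` per
    -- edge of the unpacked remainder.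
    refine ⟨fun n => 4 / (p : ℝ) ^ 2 + (2 * p - 2) * ((C * (n : ℝ) ^ (2 * p - 1)) ^ (1 / (p : ℝ)) +
      p * n), ?_, fun V _ D hD hn => ?_⟩
    · have hid : (fun n : ℕ => (n : ℝ)) =o[atTop] fun n : ℕ => (n : ℝ) ^ 2 := by
        simpa [Function.comp_def] using (isLittleO_pow_pow_atTop_of_lt (𝕜 := ℝ) (p := 1) (q := 2)
          (by norm_num)).comp_tendsto tendsto_natCast_atTop_atTop
      have hone : (fun _ : ℕ => 4 / (p : ℝ) ^ 2) =o[atTop] fun n : ℕ => (n : ℝ) ^ 2 := by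
        refine isLittleO_const_left.2 (Or.inr ?_)
        exact tendsto_norm_atTop_atTop.comp
          ((tendsto_pow_atTop two_ne_zero).comp tendsto_natCast_atTop_atTop)
      exact hone.add (((isLittleO_kst p (by omega) C (by positivity)).add
        (hid.const_mul_left _)).const_mul_left _)
    · obtain ⟨F, hdiag, hF, hFc, hacyc⟩ := exists_even_reversal hD (by omega)
      obtain ⟨R, hRF, hRfree, k, hk, hr⟩ := exists_packing (by omega) hp_even F
      have hRd : ∀ e ∈ R, ¬ e.IsDiag := fun e he => hdiag e (hRF he)
      -- Each packed copy has `p²` edges, an even number, so the remainder inherits the parity of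
      -- `F`.
      have hRe : Even R.card := by
        rw [hk, Nat.even_add] at hF
        exact hF.2 ((hp_even.pow_of_ne_zero two_ne_zero).mul_left k)
      obtain ⟨S, hRS, hS⟩ := card_le_of_edgesBetween_free (by omega) R hRd hRfree
      have hreal : Realizes p (edgeInd F) (4 * k + (2 * p - 2) * R.card) :=
        (hr.add (realizes_edgeInd hp2 hp_even hn R hRe hRd)).congr le_rfl fun u v _ => by
          simp only [Pi.add_apply]
          rw [add_assoc, edgeInd_add_self, add_zero]
      refine of_le (eqInvNumber_le hacyc hreal) ?_
      have hpR : (4 : ℝ) ≤ p := by exact_mod_cast hp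
      obtain ⟨q, hq⟩ := hp_even
      have hhalf : (p : ℝ) / 2 = (q : ℝ) := by rw [hq]; push_cast; ring
      have hqR : (q : ℝ) * q = (p : ℝ) ^ 2 / 4 := by rw [← hhalf]; ring
      rw [hhalf, Nat.ceil_natCast, Nat.floor_natCast, hqR]
      have hSR : (S : ℝ) ≤ (C * (Fintype.card V : ℝ) ^ (2 * p - 1)) ^ (1 / (p : ℝ)) := by
        rw [one_div, Real.le_rpow_inv_iff_of_pos (by positivity) (by positivity) (by linarith),
          Real.rpow_natCast]
        have : (S : ℝ) ^ p ≤ p.factorial * p * (Fintype.card V : ℝ) ^ (2 * p - 1) := by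
          exact_mod_cast hS
        exact this
      have hkR : 4 * (k : ℝ) ≤ (D.fas : ℝ) / ((p : ℝ) ^ 2 / 4) + 4 / (p : ℝ) ^ 2 := by
        have h1 : (k : ℝ) * (p : ℝ) ^ 2 ≤ D.fas + 1 := by
          exact_mod_cast (by omega : k * p ^ 2 ≤ D.fas + 1)
        have h2 : (D.fas : ℝ) / ((p : ℝ) ^ 2 / 4) + 4 / (p : ℝ) ^ 2 =
            4 * (D.fas + 1) / (p : ℝ) ^ 2 := by
          field_simp
        rw [h2, le_div_iff₀ (by positivity)]
        linarith
      have hRR : (R.card : ℝ) ≤ (C * (Fintype.card V : ℝ) ^ (2 * p - 1)) ^ (1 / (p : ℝ)) +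
          p * Fintype.card V :=
        (by exact_mod_cast hRS : (R.card : ℝ) ≤ S + p * Fintype.card V).trans
          (by linarith)
      push_cast [Nat.cast_sub (by omega : 2 ≤ 2 * p)]
      have := mul_le_mul_of_nonneg_left hRR (by linarith : (0 : ℝ) ≤ 2 * p - 2)
      linarith
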